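/- \textbf{Conventions.} Represent a quaternion $q=a+bi+cj+dk$ by the complex matrix $\begin{pmatrix}a+bi&c+di\\-c+di&a-bi\end{pmatrix}$, whose rows and columns are indexed by $1,-1$ in this order; for a quaternionic matrix $A$ let $A_{pq;ht}$ be the $(h,t)$ entry of the matrix representing $A_{pq}$. A standard quaternionic Gaussian is $\xi_0+i\xi_1+j\xi_2+k\xi_3$ with independent $\xi_r\sim N(0,\tfrac14)$. A quaternionic Ginibre matrix is $Z=\frac1{\sqrt N}G$, where $G$ is an $N\times N$ matrix with independent standard quaternionic Gaussian entries. Let $[n]=\{1,\dots,n\}$, $\pm[n]=[n]\cup(-[n])$ and $\delta(k)=-k$; permutations are composed right to left. Let $\mathrm{PM}(n)$ be the set of permutations $\alpha$ of $\pm[n]$ such that $\delta\alpha\delta=\alpha^{-1}$ and no $k$ lies in the same cycle as $-k$. Let $\#(\alpha)$ be the number of cycles of $\alpha$ (fixed points included), and let $\mathrm{FD}(\alpha)$ be the set of elements of those cycles of $\alpha$ in which the element of smallest absolute value is positive. A pairing is a permutation all of whose cycles have exactly two elements; $\alpha$ is alternating if $\alpha(k)$ always has the sign opposite to that of $k$.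 \textbf{Proposition.} Let $Z$ be an $N\times N$ quaternionic Ginibre matrix, let $n\ge 0$, and let $\iota:\pm[n]\to[N]$ and $\eta:\pm[n]\to\{1,-1\}$. Then $\prod_{k=1}^n Z_{\iota_k\iota_{-k};\eta_k\eta_{-k}}$ is integrable and $$\mathbb E\Big(\prod_{k=1}^n Z_{\iota_k\iota_{-k};\eta_k\eta_{-k}}\Big)=\sum_{\alpha}\Big[\prod_{\substack{k\in[n]\\-k\in\mathrm{FD}(\alpha)}}\eta_k\eta_{-k}\Big](2N)^{\#(\alpha)/2-n}f(\alpha),$$ where the sum is over all $\alpha\in\mathrm{PM}(n)$ such that $\iota=\iota\circ\delta\alpha$ and $\mathrm{sgn}\cdot\eta=(\mathrm{sgn}\circ\alpha)\cdot(\eta\circ\delta\alpha)$, and $f(\alpha)=1$ if $\alpha$ is an alternating pairing, $f(\alpha)=0$ otherwise. -/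

import Mathlib

open MeasureTheory ProbabilityTheory
open scoped Quaternion

/-! ### Signed indices and permutations -/

/-- The set `±[n] = {1, …, n} ∪ {-1, …, -n}`. A signed integer is stored as its absolute value
(in `Fin n`) together with its sign: `(k, 1)` is `k` and `(k, -1)` is `-k`. -/
abbrev SignedIdx (n : ℕ) : Type := Fin n × ℤˣ

/-- The sign function `sgn : ±[n] → {1, -1}`. -/
def sgnIdx {n : ℕ} (k : SignedIdx n) : ℤˣ := k.2

/-- The permutation `δ : k ↦ -k` of `±[n]`. -/
def deltaPerm (n : ℕ) : Equiv.Perm (SignedIdx n) :=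
  Equiv.prodCongr (Equiv.refl (Fin n)) (Equiv.neg ℤˣ)

/-- `PM(n)`: the permutations `α` of `±[n]` with `δ α δ = α⁻¹` such that no `k` lies in the same
cycle as `-k`. -/
def PM (n : ℕ) : Set (Equiv.Perm (SignedIdx n)) :=
  {α | deltaPerm n * α * deltaPerm n = α⁻¹ ∧ ∀ k, ¬ α.SameCycle k (deltaPerm n k)}

/-- The set `FD(α)`: the elements of those cycles of `α` (fixed points included) in which the
element of smallest absolute value is positive. -/
def FD {n : ℕ} (α : Equiv.Perm (SignedIdx n)) : Set (SignedIdx n) :=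
  {k | ∃ m, α.SameCycle k m ∧ sgnIdx m = 1 ∧ ∀ l, α.SameCycle k l → m.1 ≤ l.1}

/-- `#(α)`: the number of orbits of a permutation, fixed points included. -/
noncomputable def numOrbits {X : Type*} (α : Equiv.Perm X) : ℕ :=
  Nat.card (Quotient (Equiv.Perm.SameCycle.setoid α))

/-- A pairing: a permutation in which each cycle has exactly two elements, i.e. every cycle
has the form `(k, α k)` with `α k ≠ k`. -/
def IsPairing {X : Type*} (α : Equiv.Perm X) : Prop :=
  ∀ k, α k ≠ k ∧ α (α k) = k

/-- An alternating permutation of `±[n]`: the sign of `α k` is always opposite to that of `k`. -/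
def IsAlternating {n : ℕ} (α : Equiv.Perm (SignedIdx n)) : Prop :=
  ∀ k, sgnIdx (α k) = -sgnIdx k

open Classical in
/-- `f(α) = 1` if `α` is an alternating pairing, and `f(α) = 0` otherwise. -/
noncomputable def ginibreCumulant {n : ℕ} (α : PM n) : ℂ :=
  if IsPairing (α : Equiv.Perm (SignedIdx n)) ∧ IsAlternating (α : Equiv.Perm (SignedIdx n))
  then 1 else 0

/-- The index set of the topological expansion of the moment with indices `ι`, `η`: those
`α ∈ PM(n)` with `ι = ι ∘ δα` and `sgn · η = (sgn ∘ α) · (η ∘ δα)`. -/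
def compatiblePM {N n : ℕ} (ι : SignedIdx n → Fin N) (η : SignedIdx n → ℤˣ) : Set (PM n) :=
  {α | ι = ι ∘ (deltaPerm n * (α : Equiv.Perm (SignedIdx n))) ∧
    sgnIdx * η = (sgnIdx ∘ (α : Equiv.Perm (SignedIdx n))) *
      (η ∘ (deltaPerm n * (α : Equiv.Perm (SignedIdx n))))}

/-! ### Quaternions and quaternionic Gaussian matrices -/

/-- The entry `[q]_{h,t}`, `h, t ∈ {1, -1}`, of the `2 × 2` complex matrix
`(a + bi, c + di; -c + di, a - bi)` that represents the quaternion `q = a + bi + cj + dk`;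
the first row and column have index `1`, the second ones `-1`. -/
noncomputable def quatEntry (q : ℍ[ℝ]) (h t : ℤˣ) : ℂ :=
  if h = 1 then
    if t = 1 then (q.re : ℂ) + q.imI * Complex.I else (q.imJ : ℂ) + q.imK * Complex.I
  else
    if t = 1 then -(q.imJ : ℂ) + q.imK * Complex.I else (q.re : ℂ) - q.imI * Complex.I

/-- A standard quaternionic Gaussian random variable: its four real components are independent
`N(0, 1/4)` random variables. -/
structure IsStdQuaternionGaussian {Ω : Type*} [MeasurableSpace Ω] (X : Ω → ℍ[ℝ])
    (μ : Measure Ω) : Prop where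
  hasLaw : ∀ c : Fin 4,
    HasLaw (fun ω => Quaternion.equivTuple ℝ (X ω) c) (gaussianReal 0 (1 / 4)) μ
  indep : iIndepFun (fun (c : Fin 4) ω => Quaternion.equivTuple ℝ (X ω) c) μ

/-- A random `N × N` matrix whose entries are independent standard quaternionic Gaussian random
variables. For independence a quaternion is identified with the vector of its four real
components in `ℝ⁴`. -/
structure IsQuaternionGaussianMatrix {Ω : Type*} [MeasurableSpace Ω] {N : ℕ}
    (G : Ω → Matrix (Fin N) (Fin N) ℍ[ℝ]) (μ : Measure Ω) : Prop where
  gaussian : ∀ i j, IsStdQuaternionGaussian (fun ω => G ω i j) μ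
  indep : iIndepFun (fun (p : Fin N × Fin N) ω => Quaternion.equivTuple ℝ (G ω p.1 p.2)) μ

/-- A quaternionic Ginibre matrix: `Z = (1/√N) G` for a matrix `G` of independent standard
quaternionic Gaussian random variables. -/
def IsQuaternionGinibre {Ω : Type*} [MeasurableSpace Ω] {N : ℕ}
    (Z : Ω → Matrix (Fin N) (Fin N) ℍ[ℝ]) (μ : Measure Ω) : Prop :=
  ∃ G : Ω → Matrix (Fin N) (Fin N) ℍ[ℝ], IsQuaternionGaussianMatrix G μ ∧
    ∀ ω, Z ω = (1 / √(N : ℝ)) • G ω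

/-! ### Moments of Gaussian variables -/

/-! Each factor of the product is a complex linear form in the real components of `G`, which are
independent `N(0, 1/4)` variables. Wick's formula turns the moment into a sum over perfect matchings
of `[n]` of products of covariances (`integrable_and_integral_prod_linear`). The covariance of
factors `j` and `k` is `η_k η_{-k} / (2N)` when they are `Pairable` and zero otherwise
(`sum_ginibre_coeff_mul`).

On the other side, `f` keeps only alternating pairings, and those in `PM(n)` are exactly the maps
`±k ↦ ∓σ(k)` with `σ` a matching. Such a pairing has `n` cycles, so the power of `2N` is one factor
`1/(2N)` per pair; `FD` selects the larger element of each pair, so each pair contributes its sign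
once. Thus both sides agree matching by matching (`sum_compatiblePM_eq_sum_matchings`). -/

/-- The moment generating function `M(t) = exp(v t² / 2)` satisfies `M' = v t M`; differentiating
this `n` times in `t` gives the formula. Keeping `t` free is what allows the induction. -/
lemma integral_pow_mul_exp_gaussianReal (v : NNReal) (n : ℕ) (t : ℝ) :
    ∫ x, x ^ (n + 1) * Real.exp (t * x) ∂(gaussianReal 0 v) =
      v * (n * ∫ x, x ^ (n - 1) * Real.exp (t * x) ∂(gaussianReal 0 v) +
        t * ∫ x, x ^ n * Real.exp (t * x) ∂(gaussianReal 0 v)) := by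
  have hd (n : ℕ) (t : ℝ) :
      HasDerivAt (fun t => ∫ x, x ^ n * Real.exp (t * x) ∂(gaussianReal 0 v))
        (∫ x, x ^ (n + 1) * Real.exp (t * x) ∂(gaussianReal 0 v)) t :=
    hasDerivAt_integral_pow_mul_exp_real (X := fun x : ℝ => x) (by simp) n
  induction n generalizing t with
  | zero =>
    have h0 (t : ℝ) : ∫ x, x ^ 0 * Real.exp (t * x) ∂(gaussianReal 0 v) =
        Real.exp (v * t ^ 2 / 2) := by
      have := congrFun (mgf_fun_id_gaussianReal (μ := 0) (v := v)) t
      simpa [mgf] using this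
    have h1 := hd 0 t
    simp only [h0] at h1
    have h2 : HasDerivAt (fun t : ℝ => Real.exp (v * t ^ 2 / 2))
        (Real.exp (v * t ^ 2 / 2) * (v * (2 * t) / 2)) t := by
      have := (((hasDerivAt_pow 2 t).const_mul (v : ℝ)).div_const 2).exp
      simpa using this
    rw [h1.unique h2, h0]
    push_cast
    ring
  | succ n ih =>
    have h1 := hd (n + 1) t
    have h2 := (((hd (n - 1) t).const_mul (n : ℝ)).add
      ((hasDerivAt_id t).mul (hd n t))).const_mul (v : ℝ)
    have h3 := h1.congr_of_eventuallyEq (Filter.Eventually.of_forall fun s => (ih s).symm)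
    rw [h3.unique h2]
    -- Truncated `n - 1` is harmless at `n = 0`, where its coefficient vanishes.
    rcases n with _ | n
    · simp
    · simp only [Nat.add_sub_cancel, id]
      push_cast
      ring

lemma integral_pow_succ_gaussianReal (v : NNReal) (n : ℕ) :
    ∫ x, x ^ (n + 1) ∂(gaussianReal 0 v) = v * (n * ∫ x, x ^ (n - 1) ∂(gaussianReal 0 v)) := by
  simpa using integral_pow_mul_exp_gaussianReal v n 0

/-- A linear functional that sends monomials to products of moments of a centred Gaussian
satisfies the Gaussian integration by parts formula. -/
lemma map_X_mul_eq_map_pderiv {I : Type*} [Fintype I] (v : NNReal)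
    (E : MvPolynomial I ℂ →ₗ[ℂ] ℂ)
    (hE : ∀ m : I →₀ ℕ, E (MvPolynomial.monomial m 1) =
      ∏ i, ((∫ x, x ^ m i ∂(gaussianReal 0 v) : ℝ) : ℂ)) (c : I) (p : MvPolynomial I ℂ) :
    E (MvPolynomial.X c * p) = v * E (MvPolynomial.pderiv c p) := by
  classical
  have hmon (m : I →₀ ℕ) (a : ℂ) : E (MvPolynomial.monomial m a) =
      a * ∏ i, ((∫ x, x ^ m i ∂(gaussianReal 0 v) : ℝ) : ℂ) := by
    rw [← hE, ← smul_eq_mul, ← map_smul, MvPolynomial.smul_monomial, smul_eq_mul, mul_one]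
  induction p using MvPolynomial.induction_on' with
  | add p q hp hq => simp only [mul_add, map_add, hp, hq]
  | monomial m a =>
    rw [MvPolynomial.X, MvPolynomial.monomial_mul, MvPolynomial.pderiv_monomial, hmon, hmon,
      ← Finset.mul_prod_erase _ _ (Finset.mem_univ c),
      ← Finset.mul_prod_erase _ _ (Finset.mem_univ c)]
    have h1 : ∏ i ∈ Finset.univ.erase c,
          ((∫ x, x ^ (Finsupp.single c 1 + m : I →₀ ℕ) i ∂(gaussianReal 0 v) : ℝ) : ℂ) =
        ∏ i ∈ Finset.univ.erase c,
          ((∫ x, x ^ (m - Finsupp.single c 1 : I →₀ ℕ) i ∂(gaussianReal 0 v) : ℝ) : ℂ) := by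
      refine Finset.prod_congr rfl fun i hi => ?_
      have : c ≠ i := (Finset.ne_of_mem_erase hi).symm
      simp [this]
    rw [h1]
    have h2 : (Finsupp.single c 1 + m : I →₀ ℕ) c = m c + 1 := by simp [add_comm]
    have h3 : (m - Finsupp.single c 1 : I →₀ ℕ) c = m c - 1 := by simp
    rw [h2, h3, integral_pow_succ_gaussianReal]
    push_cast
    ring

/-! ### Matchings and Wick's formula -/

lemma derivation_prod {κ R A : Type*} [DecidableEq κ] [CommRing R] [CommRing A] [Algebra R A]
    (D : Derivation R A A) (S : Finset κ) (f : κ → A) :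
    D (∏ k ∈ S, f k) = ∑ j ∈ S, D (f j) * ∏ k ∈ S.erase j, f k := by
  induction S using Finset.induction_on with
  | empty => simp
  | insert a S ha ih =>
    rw [Finset.prod_insert ha, Derivation.leibniz, ih, Finset.sum_insert ha,
      Finset.erase_insert ha, smul_eq_mul, smul_eq_mul, Finset.mul_sum, add_comm, mul_comm]
    congr 1
    refine Finset.sum_congr rfl fun j hj => ?_
    have hja : a ≠ j := fun h => ha (h ▸ hj)
    rw [Finset.erase_insert_of_ne hja,
      Finset.prod_insert (fun h => ha (Finset.mem_of_mem_erase h))]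
    ring

section Wick
variable {κ : Type*} [Fintype κ] [LinearOrder κ]

/-- The involutions whose set of non-fixed points is `S`, i.e. the perfect matchings of `S`. -/
def matchings (S : Finset κ) : Finset (Equiv.Perm κ) :=
  {σ | σ * σ = 1 ∧ ∀ k, σ k ≠ k ↔ k ∈ S}

lemma mem_matchings {S : Finset κ} {σ : Equiv.Perm κ} :
    σ ∈ matchings S ↔ (∀ k, σ (σ k) = k) ∧ ∀ k, σ k ≠ k ↔ k ∈ S := by
  simp [matchings, Equiv.ext_iff]

/-- Composing with the transposition dissolves the pair `{j, k}` and leaves all other pairs alone;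
`swap_mul_mem_matchings_insert` is the inverse operation. -/
lemma swap_mul_mem_matchings_erase {S : Finset κ} {j k : κ} (hk : k ∉ S) (hj : j ∈ S)
    {σ : Equiv.Perm κ} (hσ : σ ∈ matchings (insert k S)) (hσk : σ k = j) :
    Equiv.swap k j * σ ∈ matchings (S.erase j) := by
  rw [mem_matchings] at hσ ⊢
  obtain ⟨h1, h2⟩ := hσ
  have hσj : σ j = k := by rw [← hσk, h1]
  have hjk : j ≠ k := fun h => hk (h ▸ hj)
  have key (x : κ) : (Equiv.swap k j * σ) x = if x = k then k else if x = j then j else σ x := by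
    rw [Equiv.Perm.mul_apply]
    split_ifs with h h'
    · rw [h, hσk, Equiv.swap_apply_right]
    · rw [h', hσj, Equiv.swap_apply_left]
    · refine Equiv.swap_apply_of_ne_of_ne ?_ ?_
      · rw [← hσj]; exact fun e => h' (σ.injective e)
      · rw [← hσk]; exact fun e => h (σ.injective e)
  constructor
  · intro x
    have := h1 x
    rw [key x]
    split_ifs with h h'
    · rw [key]; simp [h]
    · rw [key]; simp [h', hjk]
    · rw [key]
      have e1 : σ x ≠ k := fun e => h' (σ.injective (e.trans hσj.symm))
      have e2 : σ x ≠ j := fun e => h (σ.injective (e.trans hσk.symm))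
      simp [e1, e2, this]
  · intro x
    have := h2 x
    rw [key x]
    split_ifs with h h'
    · simp [h, hk]
    · simp [h']
    · simp [this, h, h']

lemma swap_mul_mem_matchings_insert {S : Finset κ} {j k : κ} (hk : k ∉ S) (hj : j ∈ S)
    {σ : Equiv.Perm κ} (hσ : σ ∈ matchings (S.erase j)) :
    Equiv.swap k j * σ ∈ matchings (insert k S) ∧ (Equiv.swap k j * σ) k = j := by
  rw [mem_matchings] at hσ ⊢
  obtain ⟨h1, h2⟩ := hσ
  have hσj : σ j = j := by simpa using h2 j
  have hσk : σ k = k := by simpa [hk] using h2 k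
  have hjk : j ≠ k := fun h => hk (h ▸ hj)
  have key (x : κ) : (Equiv.swap k j * σ) x = if x = k then j else if x = j then k else σ x := by
    rw [Equiv.Perm.mul_apply]
    split_ifs with h h'
    · rw [h, hσk, Equiv.swap_apply_left]
    · rw [h', hσj, Equiv.swap_apply_right]
    · refine Equiv.swap_apply_of_ne_of_ne ?_ ?_
      · intro e; exact h (σ.injective (e.trans hσk.symm))
      · intro e; exact h' (σ.injective (e.trans hσj.symm))
  refine ⟨⟨?_, ?_⟩, by simp [key]⟩
  · intro x
    have := h1 x
    rw [key x]
    split_ifs with h h'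
    · rw [key]; simp [h, hjk]
    · rw [key]; simp [h']
    · rw [key]
      have e1 : σ x ≠ k := fun e => h (σ.injective (e.trans hσk.symm))
      have e2 : σ x ≠ j := fun e => h' (σ.injective (e.trans hσj.symm))
      simp [e1, e2, this]
  · intro x
    have := h2 x
    rw [key x]
    split_ifs with h h'
    · simp [h, hjk]
    · simp [h', hj, hjk.symm]
    · simp [this, h, h']

/-- The filter `σ i < i` counts each pair at its larger element; since `k` is maximal, the pair `{j,
k}` contributes exactly `w j k`. -/
lemma prod_matching_insert {S : Finset κ} {j k : κ} (hk : k ∉ S) (hj : j ∈ S)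
    (hmax : ∀ i ∈ S, i < k) (w : κ → κ → ℂ)
    {σ : Equiv.Perm κ} (hσ : σ ∈ matchings (insert k S)) (hσk : σ k = j) :
    ∏ i ∈ insert k S with σ i < i, w (σ i) i =
      w j k * ∏ i ∈ S.erase j with (Equiv.swap k j * σ) i < i,
        w ((Equiv.swap k j * σ) i) i := by
  have hσj : σ j = k := by rw [← hσk, (mem_matchings.1 hσ).1]
  have hjk := hmax j hj
  have key (x : κ) (hx : x ∈ S.erase j) : (Equiv.swap k j * σ) x = σ x := by
    rw [Finset.mem_erase] at hx
    refine Equiv.swap_apply_of_ne_of_ne ?_ ?_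
    · rw [← hσj]; exact fun e => hx.1 (σ.injective e)
    · rw [← hσk]; exact fun e => hk (σ.injective e ▸ hx.2)
  rw [Finset.prod_filter, Finset.prod_insert hk, hσk, if_pos hjk, ← Finset.mul_prod_erase S _ hj,
    hσj, if_neg hjk.not_gt, one_mul, Finset.prod_filter]
  congr 1
  exact Finset.prod_congr rfl fun x hx => by rw [key x hx]

/-- Matchings are sorted by the partner `j` of the largest element. -/
lemma sum_matchings_insert {S : Finset κ} {k : κ} (hk : k ∉ S)
    (hmax : ∀ i ∈ S, i < k) (w : κ → κ → ℂ) :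
    ∑ σ ∈ matchings (insert k S), ∏ i ∈ insert k S with σ i < i, w (σ i) i =
      ∑ j ∈ S, w j k * ∑ σ ∈ matchings (S.erase j), ∏ i ∈ S.erase j with σ i < i, w (σ i) i := by
  have hmaps : ∀ σ ∈ matchings (insert k S), σ k ∈ S := by
    intro σ hσ
    obtain ⟨h1, h2⟩ := mem_matchings.1 hσ
    have hne : σ k ≠ k := (h2 k).2 (Finset.mem_insert_self _ _)
    have : σ k ∈ insert k S := (h2 (σ k)).1 (by rw [h1]; exact hne.symm)
    exact (Finset.mem_insert.1 this).resolve_left hne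
  rw [← Finset.sum_fiberwise_of_maps_to hmaps]
  refine Finset.sum_congr rfl fun j hj => ?_
  rw [Finset.mul_sum]
  refine Finset.sum_bij' (fun σ _ => Equiv.swap k j * σ) (fun σ _ => Equiv.swap k j * σ)
    ?_ ?_ ?_ ?_ ?_
  · intro σ hσ
    rw [Finset.mem_filter] at hσ
    exact swap_mul_mem_matchings_erase hk hj hσ.1 hσ.2
  · intro σ hσ
    rw [Finset.mem_filter]
    exact swap_mul_mem_matchings_insert hk hj hσ
  · intro σ _; simp
  · intro σ _; simp
  · intro σ hσ
    rw [Finset.mem_filter] at hσ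
    exact prod_matching_insert hk hj hmax w hσ.1 hσ.2

/-- A function of finite sets that satisfies the Wick recursion is a sum over matchings. -/
lemma eq_sum_matchings_of_recursion (w : κ → κ → ℂ) (F : Finset κ → ℂ) (h0 : F ∅ = 1)
    (hF : ∀ S k, k ∉ S → F (insert k S) = ∑ j ∈ S, w j k * F (S.erase j)) (S : Finset κ) :
    F S = ∑ σ ∈ matchings S, ∏ i ∈ S with σ i < i, w (σ i) i := by
  induction S using Finset.strongInduction with
  | H T ih =>
    rcases T.eq_empty_or_nonempty with rfl | hT
    · have : matchings (∅ : Finset κ) = {1} := by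
        ext σ
        simp only [mem_matchings, Finset.notMem_empty, iff_false, not_not, Finset.mem_singleton,
          Equiv.ext_iff, Equiv.Perm.one_apply]
        exact ⟨fun h => h.2, fun h => ⟨fun k => by rw [h, h], h⟩⟩
      simp [this, h0]
    · obtain ⟨k, S, hk, rfl, hmax⟩ : ∃ k S, k ∉ S ∧ insert k S = T ∧ ∀ i ∈ S, i < k := by
        refine ⟨T.max' hT, T.erase (T.max' hT), by simp, Finset.insert_erase (T.max'_mem hT), ?_⟩
        intro i hi
        rw [Finset.mem_erase] at hi
        exact lt_of_le_of_ne (T.le_max' i hi.2) hi.1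
      rw [hF S k hk, sum_matchings_insert hk hmax]
      refine Finset.sum_congr rfl fun j hj => ?_
      rw [ih (S.erase j) ?_]
      exact Finset.ssubset_of_subset_of_ssubset (Finset.erase_subset _ _)
        (Finset.ssubset_insert hk)

/-- Wick's formula for products of linear forms, for a functional that satisfies the Gaussian
integration by parts formula. -/
lemma map_prod_linear_eq_sum_matchings {I : Type*} [Fintype I] (v : ℂ)
    (E : MvPolynomial I ℂ →ₗ[ℂ] ℂ) (h1 : E 1 = 1)
    (hE : ∀ c p, E (MvPolynomial.X c * p) = v * E (MvPolynomial.pderiv c p))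
    (a : κ → I → ℂ) (S : Finset κ) :
    E (∏ k ∈ S, ∑ c, MvPolynomial.C (a k c) * MvPolynomial.X c) =
      ∑ σ ∈ matchings S, ∏ k ∈ S with σ k < k, (v * ∑ c, a (σ k) c * a k c) := by
  classical
  refine eq_sum_matchings_of_recursion (fun j k => v * ∑ c, a j c * a k c)
    (fun S => E (∏ k ∈ S, ∑ c, MvPolynomial.C (a k c) * MvPolynomial.X c)) (by simpa using h1)
    (fun S k hk => ?_) S
  have hC (x : ℂ) (p : MvPolynomial I ℂ) : E (MvPolynomial.C x * p) = x * E p := by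
    rw [← MvPolynomial.smul_eq_C_mul, map_smul, smul_eq_mul]
  have hL (j : κ) (c : I) : MvPolynomial.pderiv c
      (∑ c, MvPolynomial.C (a j c) * MvPolynomial.X c) = MvPolynomial.C (a j c) := by
    simp [MvPolynomial.pderiv_C_mul, MvPolynomial.pderiv_X, Pi.single_apply, -Derivation.leibniz]
  -- Integration by parts is applied to the variables of the `k`-th form; `∂_c` then hits each other
  -- form `j` in turn and leaves its coefficient `a j c`.
  simp only [Finset.prod_insert hk, Finset.sum_mul, map_sum, mul_assoc, hC, hE, derivation_prod,
    hL, Finset.mul_sum]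
  rw [Finset.sum_comm]
  refine Finset.sum_congr rfl fun j _ => Finset.sum_congr rfl fun c _ => ?_
  ring

end Wick

/-! ### Alternating pairings in `PM(n)` -/

lemma sameCycle_iff_of_sq_eq_one {X : Type*} {α : Equiv.Perm X} (h : ∀ x, α (α x) = x) {x y : X} :
    α.SameCycle x y ↔ y = x ∨ y = α x := by
  constructor
  · rintro ⟨i, rfl⟩
    have h2 : α ^ (2 : ℤ) = 1 := by
      ext x
      exact h x
    rcases Int.even_or_odd' i with ⟨m, rfl | rfl⟩
    · left; rw [zpow_mul, h2, one_zpow]; rfl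
    · right; rw [zpow_add, zpow_mul, h2, one_zpow, one_mul, zpow_one]
  · rintro (rfl | rfl)
    · exact Equiv.Perm.SameCycle.refl _ _
    · exact ⟨1, by simp⟩

section AlternatingPairing
variable {n : ℕ}

/-- The alternating permutation `±k ↦ ∓σ(k)` of `±[n]` given by a permutation `σ` of `[n]`. -/
def alternatingPerm (σ : Equiv.Perm (Fin n)) : Equiv.Perm (SignedIdx n) :=
  Equiv.prodCongr σ (Equiv.neg ℤˣ)

@[simp] lemma alternatingPerm_apply (σ : Equiv.Perm (Fin n)) (k : SignedIdx n) :
    alternatingPerm σ k = (σ k.1, -k.2) := rfl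

@[simp] lemma deltaPerm_apply (k : SignedIdx n) : deltaPerm n k = (k.1, -k.2) := rfl

lemma alternatingPerm_injective : Function.Injective (alternatingPerm (n := n)) := by
  intro σ τ h
  ext k
  have := congrArg (fun α : Equiv.Perm (SignedIdx n) => (α (k, 1)).1) h
  exact congrArg Fin.val this

lemma sameCycle_alternatingPerm {σ : Equiv.Perm (Fin n)} (hσ : σ ∈ matchings Finset.univ)
    {k l : SignedIdx n} :
    (alternatingPerm σ).SameCycle k l ↔ l = k ∨ l = (σ k.1, -k.2) :=
  sameCycle_iff_of_sq_eq_one fun k => by simp [(mem_matchings.1 hσ).1]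

lemma alternatingPerm_mem_PM {σ : Equiv.Perm (Fin n)} (hσ : σ ∈ matchings Finset.univ) :
    alternatingPerm σ ∈ PM n := by
  obtain ⟨h1, h2⟩ := mem_matchings.1 hσ
  constructor
  · rw [eq_inv_iff_mul_eq_one]
    ext k <;> simp [h1]
  · intro k hk
    rw [sameCycle_alternatingPerm hσ] at hk
    rcases hk with h | h
    · exact units_ne_neg_self k.2 (congrArg Prod.snd h).symm
    · exact (h2 k.1).2 (Finset.mem_univ _) (congrArg Prod.fst h).symm

lemma isPairing_alternatingPerm {σ : Equiv.Perm (Fin n)} (hσ : σ ∈ matchings Finset.univ) :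
    IsPairing (alternatingPerm σ) := by
  obtain ⟨h1, h2⟩ := mem_matchings.1 hσ
  refine fun k => ⟨fun h => ?_, by simp [h1]⟩
  exact (h2 k.1).2 (Finset.mem_univ _) (congrArg Prod.fst h)

lemma isAlternating_alternatingPerm (σ : Equiv.Perm (Fin n)) :
    IsAlternating (alternatingPerm σ) := fun _ => rfl

/-- An involution with `δαδ = α⁻¹` commutes with `δ`, so alternation makes it determined by `σ(k) =
|α(k)|`. A fixed point of `σ` would mean `α(k) = -k`, which `PM` excludes. -/
lemma exists_alternatingPerm_eq {α : Equiv.Perm (SignedIdx n)} (hα : α ∈ PM n)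
    (hp : IsPairing α) (ha : IsAlternating α) :
    ∃ σ ∈ matchings Finset.univ, alternatingPerm σ = α := by
  have hinv : α⁻¹ = α := by
    rw [inv_eq_iff_mul_eq_one]
    ext1 k
    exact (hp k).2
  have hδ (k : SignedIdx n) : α (k.1, -k.2) = ((α k).1, -(α k).2) := by
    have h : deltaPerm n (α (deltaPerm n k)) = α k := by
      have := Equiv.congr_fun hα.1 k
      rwa [hinv] at this
    rw [← h]
    simp
  have h1 (k : Fin n) : α (k, 1) = ((α (k, 1)).1, -1) := Prod.ext rfl (ha (k, 1))
  have h2 (k : Fin n) : α (k, -1) = ((α (k, 1)).1, 1) := by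
    have := hδ (k, 1)
    rw [this, h1]
    simp
  have hinvol : Function.Involutive fun k : Fin n => (α (k, 1)).1 := by
    intro k
    have := (hp (k, 1)).2
    rw [h1 k, h2] at this
    exact congrArg Prod.fst this
  refine ⟨hinvol.toPerm, mem_matchings.2 ⟨fun k => hinvol k, fun k => ?_⟩, ?_⟩
  · simp only [Finset.mem_univ, iff_true]
    intro h
    refine hα.2 (k, 1) ((sameCycle_iff_of_sq_eq_one fun x => (hp x).2).2 (Or.inr ?_))
    rw [h1 k]
    exact Prod.ext h.symm rfl
  · refine Equiv.ext fun ⟨k, s⟩ => ?_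
    rcases Int.units_eq_one_or s with rfl | rfl
    · rw [h1 k]; rfl
    · rw [h2 k]; rfl

/-- Every cycle `{k, -σ(k)}` contains exactly one positive element. -/
lemma numOrbits_alternatingPerm {σ : Equiv.Perm (Fin n)} (hσ : σ ∈ matchings Finset.univ) :
    numOrbits (alternatingPerm σ) = n := by
  have hb : Function.Bijective fun k : Fin n =>
      (Quotient.mk (Equiv.Perm.SameCycle.setoid (alternatingPerm σ)) (k, 1)) := by
    constructor
    · intro k l h
      have h' : (alternatingPerm σ).SameCycle (k, 1) (l, 1) := Quotient.exact h
      rw [sameCycle_alternatingPerm hσ] at h'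
      rcases h' with h | h
      · exact (congrArg Prod.fst h).symm
      · exact absurd (congrArg Prod.snd h) (units_ne_neg_self 1)
    · refine Quotient.ind fun ⟨k, s⟩ => ?_
      rcases Int.units_eq_one_or s with rfl | rfl
      · exact ⟨k, rfl⟩
      · refine ⟨σ k, Quotient.sound ?_⟩
        change (alternatingPerm σ).SameCycle _ _
        rw [sameCycle_alternatingPerm hσ]
        simp [(mem_matchings.1 hσ).1]
  rw [numOrbits, ← Nat.card_eq_of_bijective _ hb, Nat.card_fin]

lemma mem_FD_alternatingPerm {σ : Equiv.Perm (Fin n)} (hσ : σ ∈ matchings Finset.univ)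
    (k : Fin n) : (k, -1) ∈ FD (alternatingPerm σ) ↔ σ k < k := by
  have hne : σ k ≠ k := ((mem_matchings.1 hσ).2 k).2 (Finset.mem_univ k)
  simp only [FD, Set.mem_ofPred_eq, sameCycle_alternatingPerm hσ, sgnIdx, neg_neg]
  constructor
  · rintro ⟨m, rfl | rfl, h, hm⟩
    · exact absurd h.symm (units_ne_neg_self 1)
    · exact lt_of_le_of_ne (hm _ (Or.inl rfl)) hne
  · intro h
    refine ⟨(σ k, 1), Or.inr rfl, rfl, ?_⟩
    rintro l (rfl | rfl)
    · exact h.le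
    · exact le_rfl

/-- `σ` exchanges the larger and the smaller elements of the pairs. -/
lemma card_matching_gt {σ : Equiv.Perm (Fin n)} (hσ : σ ∈ matchings Finset.univ) :
    2 * (Finset.univ.filter fun k => σ k < k).card = n := by
  obtain ⟨h1, h2⟩ := mem_matchings.1 hσ
  have h : (Finset.univ.filter fun k => σ k < k).card =
      (Finset.univ.filter fun k => ¬ σ k < k).card := by
    refine Finset.card_bij' (fun k _ => σ k) (fun k _ => σ k) ?_ ?_ ?_ ?_
    · intro k hk
      simp only [Finset.mem_filter, Finset.mem_univ, true_and, h1] at hk ⊢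
      exact hk.not_gt
    · intro k hk
      simp only [Finset.mem_filter, Finset.mem_univ, true_and, h1] at hk ⊢
      exact lt_of_le_of_ne (not_lt.1 hk) ((h2 k).2 (Finset.mem_univ k)).symm
    · intro k _; exact h1 k
    · intro k _; exact h1 k
  have := Finset.card_filter_add_card_filter_not (s := (Finset.univ : Finset (Fin n)))
    (fun k => σ k < k)
  rw [Finset.card_fin] at this
  omega

/-- Two positions `j, k` can be paired if they carry the same matrix entry and opposite row and
column labels of the `2 × 2` representation. -/
def Pairable {N : ℕ} (ι : SignedIdx n → Fin N) (η : SignedIdx n → ℤˣ) (j k : Fin n) : Prop :=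
  ∀ s, ι (k, s) = ι (j, s) ∧ η (k, s) = -η (j, s)

/-- Here `δα` sends `(k, s)` to `(σ k, s)` and `α` flips the sign, which forces opposite values of
`η`. As `Pairable` is symmetric, one check per pair suffices. -/
lemma compatible_alternatingPerm_iff {N : ℕ} {ι : SignedIdx n → Fin N} {η : SignedIdx n → ℤˣ}
    {σ : Equiv.Perm (Fin n)} (hσ : σ ∈ matchings Finset.univ) :
    (⟨alternatingPerm σ, alternatingPerm_mem_PM hσ⟩ : PM n) ∈ compatiblePM ι η ↔
      ∀ k, σ k < k → Pairable ι η (σ k) k := by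
  obtain ⟨h1, h2⟩ := mem_matchings.1 hσ
  have hall : (⟨alternatingPerm σ, alternatingPerm_mem_PM hσ⟩ : PM n) ∈ compatiblePM ι η ↔
      ∀ k, Pairable ι η (σ k) k := by
    simp only [compatiblePM, Set.mem_ofPred_eq, funext_iff, Pi.mul_apply, Function.comp_apply,
      Equiv.Perm.mul_apply, alternatingPerm_apply, deltaPerm_apply, sgnIdx, neg_neg, Prod.forall,
      neg_mul, Pairable]
    rw [← forall_and]
    refine forall_congr' fun k => ?_
    rw [← forall_and]
    refine forall_congr' fun s => and_congr_right fun _ => ?_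
    rw [← mul_neg, mul_right_inj]
  rw [hall]
  refine ⟨fun h k _ => h k, fun h k => ?_⟩
  rcases lt_or_gt_of_ne ((h2 k).2 (Finset.mem_univ k)) with hk | hk
  · exact h k hk
  · have := h (σ k) (by rwa [h1])
    rw [h1] at this
    exact fun s => ⟨(this s).1.symm, by rw [(this s).2, neg_neg]⟩

open Classical in
/-- The topological expansion is a sum over the matchings of `[n]`. -/
lemma sum_compatiblePM_eq_sum_matchings {N : ℕ} (ι : SignedIdx n → Fin N) (η : SignedIdx n → ℤˣ) :
    ∑ α : PM n with α ∈ compatiblePM ι η,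
        (∏ k : Fin n with (k, -1) ∈ FD (α : Equiv.Perm (SignedIdx n)),
          (((η (k, 1) * η (k, -1) : ℤˣ) : ℤ) : ℂ)) *
        (((2 * N : ℝ) ^ ((numOrbits (α : Equiv.Perm (SignedIdx n)) : ℝ) / 2 - n) : ℝ) : ℂ) *
        ginibreCumulant α =
      ∑ σ ∈ matchings (Finset.univ : Finset (Fin n)), ∏ k : Fin n with σ k < k,
        if Pairable ι η (σ k) k then (((η (k, 1) * η (k, -1) : ℤˣ) : ℤ) : ℂ) / (2 * N) else 0 := by
  have hpow {σ : Equiv.Perm (Fin n)} (hσ : σ ∈ matchings Finset.univ) :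
      (((2 * N : ℝ) ^ ((numOrbits (alternatingPerm σ) : ℝ) / 2 - n) : ℝ) : ℂ) =
        ∏ k : Fin n with σ k < k, ((2 * N : ℂ))⁻¹ := by
    rw [Finset.prod_const, numOrbits_alternatingPerm hσ]
    generalize hc : (Finset.univ.filter fun k => σ k < k).card = c
    have hn : (n : ℝ) = 2 * c := by rw [← hc]; exact_mod_cast (card_matching_gt hσ).symm
    have : (n : ℝ) / 2 - n = -(c : ℝ) := by rw [hn]; ring
    rw [this, Real.rpow_neg (by positivity), Real.rpow_natCast]
    push_cast
    rw [inv_pow]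
  symm
  -- Only nonzero terms are matched: those `σ` with all pairs `Pairable`, and those compatible `α`
  -- that are alternating pairings.
  refine Finset.sum_bij_ne_zero
    (fun σ hσ _ => (⟨alternatingPerm σ, alternatingPerm_mem_PM hσ⟩ : PM n)) ?_ ?_ ?_ ?_
  · intro σ hσ h0
    rw [Finset.mem_filter]
    refine ⟨Finset.mem_univ _, (compatible_alternatingPerm_iff hσ).2 fun k hk => ?_⟩
    by_contra hc
    exact h0 (Finset.prod_eq_zero (Finset.mem_filter.2 ⟨Finset.mem_univ k, hk⟩) (if_neg hc))
  · intro σ _ _ τ _ _ h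
    exact alternatingPerm_injective (congrArg Subtype.val h)
  · rintro ⟨α, hα⟩ hc h0
    have hf : IsPairing α ∧ IsAlternating α := by
      by_contra hf
      exact h0 (by rw [ginibreCumulant, if_neg hf, mul_zero])
    obtain ⟨σ, hσ, rfl⟩ := exists_alternatingPerm_eq hα hf.1 hf.2
    refine ⟨σ, hσ, ?_, rfl⟩
    rw [Finset.mem_filter, compatible_alternatingPerm_iff hσ] at hc
    have h1 := left_ne_zero_of_mul h0
    simp only [hpow hσ, mem_FD_alternatingPerm hσ, ← Finset.prod_mul_distrib] at h1
    convert h1 using 1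
    refine Finset.prod_congr rfl fun k hk => ?_
    rw [if_pos (hc.2 k (Finset.mem_filter.1 hk).2), div_eq_mul_inv]
  · intro σ hσ h0
    have hc : ∀ k, σ k < k → Pairable ι η (σ k) k := by
      intro k hk
      by_contra hc
      exact h0 (Finset.prod_eq_zero (Finset.mem_filter.2 ⟨Finset.mem_univ k, hk⟩) (if_neg hc))
    have hf : ginibreCumulant ⟨alternatingPerm σ, alternatingPerm_mem_PM hσ⟩ = 1 :=
      if_pos ⟨isPairing_alternatingPerm hσ, isAlternating_alternatingPerm σ⟩
    simp only [hf, mul_one, hpow hσ, mem_FD_alternatingPerm hσ, ← Finset.prod_mul_distrib]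
    refine Finset.prod_congr rfl fun k hk => ?_
    rw [if_pos (hc k (Finset.mem_filter.1 hk).2), div_eq_mul_inv]

end AlternatingPairing

/-! ### Polynomials in the entries of a quaternionic Gaussian matrix -/

section Moments
variable {Ω : Type*} [MeasurableSpace Ω] {μ : Measure Ω}

/-- Hölder's inequality with exponents `2p`, `2p`. -/
lemma MeasureTheory.MemLp.mul_of_forall {f g : Ω → ℂ} (hf : ∀ p : ENNReal, p ≠ ⊤ → MemLp f p μ)
    (hg : ∀ p : ENNReal, p ≠ ⊤ → MemLp g p μ) (p : ENNReal) (hp : p ≠ ⊤) :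
    MemLp (fun ω => f ω * g ω) p μ := by
  have h2 : 2 * p ≠ ⊤ := ENNReal.mul_ne_top (by simp) hp
  have : ENNReal.HolderTriple (2 * p) (2 * p) p := ⟨by
    rw [ENNReal.mul_inv (by simp) (by simp), ← add_mul, ENNReal.inv_two_add_inv_two, one_mul]⟩
  exact (hg _ h2).mul' (hf _ h2)

lemma memLp_eval_mvPolynomial [IsFiniteMeasure μ] {I : Type*} {X : I → Ω → ℝ}
    (hX : ∀ i (p : ENNReal), p ≠ ⊤ → MemLp (X i) p μ) (P : MvPolynomial I ℂ) (p : ENNReal)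
    (hp : p ≠ ⊤) : MemLp (fun ω => MvPolynomial.eval (fun i => (X i ω : ℂ)) P) p μ := by
  induction P using MvPolynomial.induction_on generalizing p with
  | C a => simpa using memLp_const a
  | add P Q hP hQ => simpa only [map_add] using! (hP p hp).add (hQ p hp)
  | mul_X P i hP =>
    simpa using MemLp.mul_of_forall hP (fun q hq => (hX i q hq).ofReal) p hp

lemma ProbabilityTheory.HasLaw.memLp_gaussianReal {X : Ω → ℝ} {m : ℝ} {v : NNReal}
    (hX : HasLaw X (gaussianReal m v) μ) (p : ENNReal) (hp : p ≠ ⊤) : MemLp X p μ := by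
  have h := memLp_id_gaussianReal' (μ := m) (v := v) p hp
  rw [← hX.map_eq] at h
  exact h.comp_of_map hX.aemeasurable

/-- The real components of the entries of a random quaternionic matrix. -/
noncomputable def entryComponent {N : ℕ} (G : Ω → Matrix (Fin N) (Fin N) ℍ[ℝ])
    (i : (Fin N × Fin N) × Fin 4) (ω : Ω) : ℝ :=
  Quaternion.equivTuple ℝ (G ω i.1.1 i.1.2) i.2

variable {N : ℕ} {G : Ω → Matrix (Fin N) (Fin N) ℍ[ℝ]}

/-- Independence is used twice: between matrix entries, then between the four components of each
entry. -/
lemma integral_prod_entryComponent_pow (hG : IsQuaternionGaussianMatrix G μ)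
    (m : (Fin N × Fin N) × Fin 4 → ℕ) :
    ∫ ω, ∏ i, entryComponent G i ω ^ m i ∂μ =
      ∏ i, ∫ x, x ^ m i ∂(gaussianReal 0 (1 / 4)) := by
  have hm (p : Fin N × Fin N) (c : Fin 4) :
      AEMeasurable (fun ω => Quaternion.equivTuple ℝ (G ω p.1 p.2) c) μ :=
    ((hG.gaussian p.1 p.2).hasLaw c).aemeasurable
  simp only [Fintype.prod_prod_type (α₁ := Fin N × Fin N), entryComponent]
  rw [hG.indep.integral_fun_prod_comp (f := fun p x => ∏ c, x c ^ m (p, c))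
    (fun p => aemeasurable_pi_iff.2 (hm p))
    (fun p => by
      have : Measurable fun x : Fin 4 → ℝ => ∏ c, x c ^ m (p, c) := by fun_prop
      exact this.aestronglyMeasurable)]
  refine Finset.prod_congr rfl fun p _ => ?_
  rw [(hG.gaussian p.1 p.2).indep.integral_fun_prod_comp (f := fun c x => x ^ m (p, c)) (hm p)
    (fun c => by
      have : Measurable fun x : ℝ => x ^ m (p, c) := by fun_prop
      exact this.aestronglyMeasurable)]
  refine Finset.prod_congr rfl fun c _ => ?_
  exact ((hG.gaussian p.1 p.2).hasLaw c).integral_comp (f := fun x => x ^ m (p, c))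
    (by fun_prop)

/-- Integrability and Wick's formula for products of complex linear forms in the components of a
quaternionic Gaussian matrix. -/
lemma integrable_and_integral_prod_linear [IsProbabilityMeasure μ]
    (hG : IsQuaternionGaussianMatrix G μ) {n : ℕ}
    (a : Fin n → (Fin N × Fin N) × Fin 4 → ℂ) :
    Integrable (fun ω => ∏ k, ∑ i, a k i * (entryComponent G i ω : ℂ)) μ ∧
    ∫ ω, ∏ k, ∑ i, a k i * (entryComponent G i ω : ℂ) ∂μ =
      ∑ σ ∈ matchings Finset.univ, ∏ k with σ k < k, (1 / 4 * ∑ i, a (σ k) i * a k i) := by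
  have hX (i) (p : ENNReal) (hp : p ≠ ⊤) : MemLp (entryComponent G i) p μ :=
    HasLaw.memLp_gaussianReal ((hG.gaussian i.1.1 i.1.2).hasLaw i.2) p hp
  have hint (P : MvPolynomial ((Fin N × Fin N) × Fin 4) ℂ) :
      Integrable (fun ω => MvPolynomial.eval (fun i => (entryComponent G i ω : ℂ)) P) μ :=
    memLp_one_iff_integrable.1 (memLp_eval_mvPolynomial hX P 1 (by simp))
  -- Expectation, viewed as a functional on polynomials, satisfies integration by parts because its
  -- values on monomials are products of Gaussian moments.
  let E : MvPolynomial ((Fin N × Fin N) × Fin 4) ℂ →ₗ[ℂ] ℂ :=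
    { toFun := fun P => ∫ ω, MvPolynomial.eval (fun i => (entryComponent G i ω : ℂ)) P ∂μ
      map_add' := fun P Q => by
        simp only [map_add]
        exact integral_add (hint P) (hint Q)
      map_smul' := fun c P => by
        simp only [MvPolynomial.smul_eval]
        exact integral_const_mul c _ }
  have hE (P) : E P = ∫ ω, MvPolynomial.eval (fun i => (entryComponent G i ω : ℂ)) P ∂μ := rfl
  have hmon (m : (Fin N × Fin N) × Fin 4 →₀ ℕ) : E (MvPolynomial.monomial m 1) =
      ∏ i, ((∫ x, x ^ m i ∂(gaussianReal 0 (1 / 4)) : ℝ) : ℂ) := by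
    rw [hE, ← Complex.ofReal_prod, ← integral_prod_entryComponent_pow hG, ← integral_complex_ofReal]
    refine integral_congr_ae (Filter.Eventually.of_forall fun ω => ?_)
    simp [MvPolynomial.eval_monomial, Finsupp.prod_fintype]
  have heval (ω : Ω) : MvPolynomial.eval (fun i => (entryComponent G i ω : ℂ))
      (∏ k, ∑ i, MvPolynomial.C (a k i) * MvPolynomial.X i) =
        ∏ k, ∑ i, a k i * (entryComponent G i ω : ℂ) := by
    simp
  refine ⟨(hint _).congr (Filter.Eventually.of_forall heval), ?_⟩
  have hw := map_prod_linear_eq_sum_matchings _ E (by simp [hE])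
    (map_X_mul_eq_map_pderiv (1 / 4) E hmon) a Finset.univ
  simp only [hE, heval] at hw
  rw [hw]
  simp

end Moments

/-! ### The entries of the complex representation of quaternions -/

/-- The coefficients of `quatEntry q h t` as a linear form in the components of `q`. -/
noncomputable def quatCoeff (h t : ℤˣ) : Fin 4 → ℂ :=
  if h = 1 then
    if t = 1 then ![1, Complex.I, 0, 0] else ![0, 0, 1, Complex.I]
  else
    if t = 1 then ![0, 0, -1, Complex.I] else ![1, -Complex.I, 0, 0]

lemma quatEntry_eq_sum (q : ℍ[ℝ]) (h t : ℤˣ) :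
    quatEntry q h t = ∑ c, quatCoeff h t c * (Quaternion.equivTuple ℝ q c : ℂ) := by
  unfold quatEntry quatCoeff
  split_ifs <;> simp [Fin.sum_univ_four, Quaternion.equivTuple_apply] <;> ring

lemma quatEntry_smul (r : ℝ) (q : ℍ[ℝ]) (h t : ℤˣ) :
    quatEntry (r • q) h t = r * quatEntry q h t := by
  unfold quatEntry
  split_ifs <;> simp <;> ring

/-- The pairing is bilinear, without conjugation: `1 + I² = 0` kills an entry against itself, while
opposite corners give `1 - I² = 2` on the diagonal and `-1 + I² = -2` off it. -/
lemma sum_quatCoeff_mul_quatCoeff (h t h' t' : ℤˣ) :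
    ∑ c, quatCoeff h' t' c * quatCoeff h t c =
      if h = -h' ∧ t = -t' then 2 * (((h * t : ℤˣ) : ℤ) : ℂ) else 0 := by
  have h1 : (1 : ℤˣ) ≠ -1 := by decide
  have h2 : (-1 : ℤˣ) ≠ 1 := by decide
  rcases Int.units_eq_one_or h with rfl | rfl <;> rcases Int.units_eq_one_or t with rfl | rfl <;>
  rcases Int.units_eq_one_or h' with rfl | rfl <;> rcases Int.units_eq_one_or t' with rfl | rfl <;>
  simp [quatCoeff, Fin.sum_univ_four, h1, h2] <;> norm_num

open Classical in
-- The constant is `1/4 · 2 · 1/N`: component variance, the sum over components, and the scaling of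
-- `Z`.
lemma sum_ginibre_coeff_mul {N n : ℕ} (ι : SignedIdx n → Fin N) (η : SignedIdx n → ℤˣ)
    (j k : Fin n) :
    (1 / 4 : ℂ) * ∑ i : (Fin N × Fin N) × Fin 4,
      (if i.1 = (ι (j, 1), ι (j, -1)) then
        ((1 / √(N : ℝ) : ℝ) : ℂ) * quatCoeff (η (j, 1)) (η (j, -1)) i.2 else 0) *
      (if i.1 = (ι (k, 1), ι (k, -1)) then
        ((1 / √(N : ℝ) : ℝ) : ℂ) * quatCoeff (η (k, 1)) (η (k, -1)) i.2 else 0) =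
    if Pairable ι η j k then (((η (k, 1) * η (k, -1) : ℤˣ) : ℤ) : ℂ) / (2 * N) else 0 := by
  have hN : ((1 / √(N : ℝ) : ℝ) : ℂ) * ((1 / √(N : ℝ) : ℝ) : ℂ) = (N : ℂ)⁻¹ := by
    rw [← Complex.ofReal_mul, div_mul_div_comm, Real.mul_self_sqrt (Nat.cast_nonneg N)]
    simp
  have hpair : Pairable ι η j k ↔ (ι (j, 1), ι (j, -1)) = (ι (k, 1), ι (k, -1)) ∧
      η (k, 1) = -η (j, 1) ∧ η (k, -1) = -η (j, -1) := by
    rw [Prod.mk.injEq]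
    constructor
    · exact fun h => ⟨⟨(h 1).1.symm, (h (-1)).1.symm⟩, (h 1).2, (h (-1)).2⟩
    · rintro ⟨⟨h1, h2⟩, h3, h4⟩ s
      rcases Int.units_eq_one_or s with rfl | rfl
      · exact ⟨h1.symm, h3⟩
      · exact ⟨h2.symm, h4⟩
  rw [Fintype.sum_prod_type, Finset.sum_eq_single (ι (j, 1), ι (j, -1))]
  · by_cases hι : (ι (j, 1), ι (j, -1)) = (ι (k, 1), ι (k, -1))
    · simp only [if_true, mul_mul_mul_comm _ (quatCoeff _ _ _), hN, ← Finset.mul_sum,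
        sum_quatCoeff_mul_quatCoeff, hpair, hι, true_and]
      split_ifs
      · rw [div_eq_mul_inv _ ((2 : ℂ) * N), mul_inv (2 : ℂ)]
        ring
      · simp
    · simp [hι, hpair]
  · intro p _ hp
    simp [hp]
  · simp

open Classical in
theorem mainTheorem5 {Ω : Type*} [MeasurableSpace Ω] (μ : Measure Ω) [IsProbabilityMeasure μ]
    {N : ℕ} (Z : Ω → Matrix (Fin N) (Fin N) ℍ[ℝ]) (hZ : IsQuaternionGinibre Z μ)
    (n : ℕ) (ι : SignedIdx n → Fin N) (η : SignedIdx n → ℤˣ) :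
    Integrable (fun ω => ∏ k : Fin n,
      quatEntry (Z ω (ι (k, 1)) (ι (k, -1))) (η (k, 1)) (η (k, -1))) μ ∧
    ∫ ω, ∏ k : Fin n, quatEntry (Z ω (ι (k, 1)) (ι (k, -1))) (η (k, 1)) (η (k, -1)) ∂μ =
      ∑ α : PM n with α ∈ compatiblePM ι η,
        (∏ k : Fin n with (k, -1) ∈ FD (α : Equiv.Perm (SignedIdx n)),
          (((η (k, 1) * η (k, -1) : ℤˣ) : ℤ) : ℂ)) *
        (((2 * N : ℝ) ^ ((numOrbits (α : Equiv.Perm (SignedIdx n)) : ℝ) / 2 - n) : ℝ) : ℂ) *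
        ginibreCumulant α := by
  obtain ⟨G, hG, hZG⟩ := hZ
  have hlin (k : Fin n) (ω : Ω) :
      quatEntry (Z ω (ι (k, 1)) (ι (k, -1))) (η (k, 1)) (η (k, -1)) =
        ∑ i : (Fin N × Fin N) × Fin 4, (if i.1 = (ι (k, 1), ι (k, -1)) then
          ((1 / √(N : ℝ) : ℝ) : ℂ) * quatCoeff (η (k, 1)) (η (k, -1)) i.2 else 0) *
            (entryComponent G i ω : ℂ) := by
    rw [hZG, Matrix.smul_apply, quatEntry_smul, quatEntry_eq_sum, Fintype.sum_prod_type,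
      Finset.sum_eq_single (ι (k, 1), ι (k, -1))]
    · simp only [if_true, Finset.mul_sum, mul_assoc, entryComponent]
    · intro p _ hp
      simp [hp]
    · simp
  simp only [hlin, sum_compatiblePM_eq_sum_matchings, ← sum_ginibre_coeff_mul]
  exact integrable_and_integral_prod_linear hG _
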